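/- Let $V$ be a $4$-dimensional real vector space, let $\langle\cdot,\cdot\rangle$ be a non-degenerate symmetric bilinear form on $V$ of signature $(2,2)$, and let $A\in\otimes^4(V^*)$ be an algebraic curvature tensor, i.e. $$A(x,y,z,v)=-A(y,x,z,v)=A(z,v,x,y),\qquad A(x,y,z,v)+A(y,z,x,v)+A(z,x,y,v)=0 .$$ The Jacobi operator $\mathcal J_A(x):V\to V$ is defined by $\langle\mathcal J_A(x)y,z\rangle=A(y,x,x,z)$. Let $S^{\pm}=\{x\in V:\langle x,x\rangle=\pm1\}$ be the sets of unit spacelike $(+)$ and unit timelike $(-)$ vectors, and let $N=\{x\in V: x\neq0,\ \langle x,x\rangle=0\}$ be the set of non-zero null vectors. The model $\mathfrak M=(V,\langle\cdot,\cdot\rangle,A)$ is called spacelike, timelike, or null Osserman if the set of complex eigenvalues of $\mathcal J_A(x)$ is the same for all $x$ in $S^+$, $S^-$, or $N$, respectively; it is called spacelike (timelike) Jordan Osserman if the Jordan normal form of $\mathcal J_A(x)$ is the same for all $x\in S^+$ ($x\in S^-$), that is, if any two of these operators are conjugate. For a basis $\{e_i\}$ of $V$ with $g_{ij}=\langle e_i,e_j\rangle$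 and inverse matrix $(g^{ij})$, let $\rho(x,y)=\sum_{i,j}g^{ij}A(e_i,x,y,e_j)$ be the Ricci tensor, $\tau=\sum_{i,j}g^{ij}\rho(e_i,e_j)$ the scalar curvature, and $$\begin{aligned}W(x,y,z,v)={}&A(x,y,z,v)+\tfrac16\tau\{\langle y,z\rangle\langle x,v\rangle-\langle x,z\rangle\langle y,v\rangle\}\\&-\tfrac12\{\rho(y,z)\langle x,v\rangle-\rho(x,z)\langle y,v\rangle+\rho(x,v)\langle y,z\rangle-\rho(y,v)\langle x,z\rangle\}\end{aligned}$$ the Weyl tensor. $\mathfrak M$ is Einstein if $\rho=c\,\langle\cdot,\cdot\rangle$ for some $c\in\mathbb R$. Given an orientation of $V$ and an oriented orthonormal basis $e_1,\dots,e_4$ with $e_1,e_2$ timelike and $e_3,e_4$ spacelike, the Hodge operator $\star$ on $\Lambda^2(V^*)$ is characterized by $\phi\wedge\star\theta=\langle\phi,\theta\rangle\,e^1\wedge e^2\wedge e^3\wedge e^4$. It satisfies $\star^2=\mathrm{id}$; put $\Lambda^-=\{\theta\in\Lambda^2(V^*):\star\theta=-\theta\}$. $\mathfrak M$ is self-dual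 for this orientation if the Weyl tensor, regarded as the operator $(W\theta)(x,y)=\frac12\sum_{i,j}\langle e_i,e_i\rangle\langle e_j,e_j\rangle W(x,y,e_i,e_j)\,\theta(e_i,e_j)$ on $\Lambda^2(V^*)$, vanishes on $\Lambda^-$. Then the following conditions are equivalent: 1. $\mathfrak M$ is spacelike Osserman. 2. $\mathfrak M$ is timelike Osserman. 3. $\mathfrak M$ is spacelike Jordan Osserman. 4. $\mathfrak M$ is timelike Jordan Osserman. 5. $\mathfrak M$ is Einstein and there is an orientation of $V$ for which $\mathfrak M$ is self-dual. 6. $\mathfrak M$ is null Osserman. -/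

import Mathlib

/-- A model `(V, ⟨·,·⟩, A)`: a nondegenerate symmetric bilinear form on a real vector space,
together with an algebraic curvature tensor. -/
structure CurvatureModel (V : Type*) [AddCommGroup V] [Module ℝ V] where
  form : LinearMap.BilinForm ℝ V
  form_symm : form.IsSymm
  form_nondegenerate : form.Nondegenerate
  A : V →ₗ[ℝ] V →ₗ[ℝ] V →ₗ[ℝ] V →ₗ[ℝ] ℝ
  A_antisymm : ∀ x y z v, A x y z v = -A y x z v
  A_pair_symm : ∀ x y z v, A x y z v = A z v x y
  A_bianchi : ∀ x y z v, A x y z v + A y z x v + A z x y v = 0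

/-- The two-forms `Λ²(V*)`. -/
abbrev TwoForm (V : Type*) [AddCommGroup V] [Module ℝ V] : Type _ := V [⋀^Fin 2]→ₗ[ℝ] ℝ

namespace CurvatureModel

noncomputable section

variable {V : Type*} [AddCommGroup V] [Module ℝ V]

/-- Neutral signature `(2,2)` in dimension four. -/
def IsNeutral (M : CurvatureModel V) : Prop :=
  Module.finrank ℝ V = 4 ∧
    sigPos M.form.toQuadraticMap = 2 ∧
    sigNeg M.form.toQuadraticMap = 2

/-- The spacelike unit vectors `S⁺`. -/
def spacelikeUnit (M : CurvatureModel V) : Set V := {x | M.form x x = 1}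

/-- The timelike unit vectors `S⁻`. -/
def timelikeUnit (M : CurvatureModel V) : Set V := {x | M.form x x = -1}

/-- The nonzero null vectors `N`. -/
def nullCone (M : CurvatureModel V) : Set V := {x | x ≠ 0 ∧ M.form x x = 0}

section Operators

variable [FiniteDimensional ℝ V]

/-- Raising an index: the endomorphism `T` with `⟨T y, z⟩ = B(y, z)`. -/
def raise (M : CurvatureModel V) (B : LinearMap.BilinForm ℝ V) : Module.End ℝ V :=
  (M.form.toDual M.form_nondegenerate).symm.toLinearMap ∘ₗ B

theorem form_raise (M : CurvatureModel V) (B : LinearMap.BilinForm ℝ V) (y z : V) :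
    M.form (M.raise B y) z = B y z := by
  simp [raise, LinearMap.BilinForm.apply_toDual_symm_apply]

/-- The curvature operator `z ↦ R(z, x) y`, where `⟨R(z, x) y, w⟩ = A(z, x, y, w)`. -/
def curv (M : CurvatureModel V) (x y : V) : Module.End ℝ V :=
  M.raise ((M.A.flip x).flip y)

theorem form_curv (M : CurvatureModel V) (x y z w : V) :
    M.form (M.curv x y z) w = M.A z x y w := by
  simp [curv, form_raise]

/-- The Jacobi operator `y ↦ R(y, x) x`, so that `⟨J(x) y, z⟩ = A(y, x, x, z)`. -/
def jacobi (M : CurvatureModel V) (x : V) : Module.End ℝ V := M.curv x x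

/-- The (complex) eigenvalues of the Jacobi operator `J(x)`. -/
def jacobiEigenvalues (M : CurvatureModel V) (x : V) : Set ℂ :=
  {μ | Module.End.HasEigenvalue ((M.jacobi x).baseChange ℂ) μ}

/-- The eigenvalues of the Jacobi operator are constant on `S`. -/
def OssermanOn (M : CurvatureModel V) (S : Set V) : Prop :=
  ∀ x ∈ S, ∀ y ∈ S, M.jacobiEigenvalues x = M.jacobiEigenvalues y

/-- The Jordan normal form of the Jacobi operator is constant on `S`; two endomorphisms have the
same Jordan normal form exactly when they are conjugate. -/
def JordanOssermanOn (M : CurvatureModel V) (S : Set V) : Prop :=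
  ∀ x ∈ S, ∀ y ∈ S, ∃ e : V ≃ₗ[ℝ] V, e.conj (M.jacobi x) = M.jacobi y

def SpacelikeOsserman (M : CurvatureModel V) : Prop := M.OssermanOn M.spacelikeUnit

def TimelikeOsserman (M : CurvatureModel V) : Prop := M.OssermanOn M.timelikeUnit

def NullOsserman (M : CurvatureModel V) : Prop := M.OssermanOn M.nullCone

def SpacelikeJordanOsserman (M : CurvatureModel V) : Prop := M.JordanOssermanOn M.spacelikeUnit

def TimelikeJordanOsserman (M : CurvatureModel V) : Prop := M.JordanOssermanOn M.timelikeUnit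

/-- The Ricci tensor `ρ(x, y) = ∑ gⁱʲ A(eᵢ, x, y, eⱼ)`, the trace of `z ↦ R(z, x) y`. -/
def ricci (M : CurvatureModel V) : LinearMap.BilinForm ℝ V :=
  LinearMap.mk₂ ℝ (fun x y => LinearMap.trace ℝ V (M.curv x y))
    (by
      intro x x' y
      rw [← map_add]
      congr 1
      ext z
      simp [curv, raise])
    (by
      intro c x y
      rw [← map_smul]
      congr 1
      ext z
      simp [curv, raise])
    (by intro x y y'; simp [curv, raise, LinearMap.comp_add])
    (by intro c x y; simp [curv, raise, LinearMap.comp_smul])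

/-- The scalar curvature `τ = ∑ gⁱʲ ρ(eᵢ, eⱼ)`. -/
def scalar (M : CurvatureModel V) : ℝ := LinearMap.trace ℝ V (M.raise M.ricci)

/-- `ρ = c ⟨·,·⟩` for a constant `c`. -/
def IsEinstein (M : CurvatureModel V) : Prop :=
  ∃ c : ℝ, ∀ x y, M.ricci x y = c * M.form x y

/-- The Weyl tensor of a four-dimensional model. -/
def weyl (M : CurvatureModel V) (x y z v : V) : ℝ :=
  M.A x y z v
    + 1 / 6 * M.scalar * (M.form y z * M.form x v - M.form x z * M.form y v)
    - 1 / 2 * (M.ricci y z * M.form x v - M.ricci x z * M.form y v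
        + M.ricci x v * M.form y z - M.ricci y v * M.form x z)

end Operators

/-- The signs `⟨eᵢ, eᵢ⟩` of an orthonormal basis: the first two vectors are timelike, the last
two are spacelike. -/
def frameSign : Fin 4 → ℝ := ![-1, -1, 1, 1]

/-- `b` is an orthonormal basis `e₁, e₂, e₃, e₄` (indexed from `0`) with `e₁, e₂` timelike and
`e₃, e₄` spacelike that is positively oriented for `o`. -/
def IsOrientedFrame (M : CurvatureModel V) (o : Orientation ℝ V (Fin 4))
    (b : Module.Basis (Fin 4) ℝ V) : Prop :=
  b.orientation = o ∧ ∀ i j, M.form (b i) (b j) = if i = j then frameSign i else 0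

/-- The two-form `eⁱ ∧ eʲ` built from the dual basis. -/
def dualWedge (b : Module.Basis (Fin 4) ℝ V) (i j : Fin 4) : TwoForm V :=
  (Matrix.detRowAlternating (n := Fin 2) (R := ℝ)).compLinearMap
    (LinearMap.pi ![b.coord i, b.coord j])

theorem dualWedge_apply (b : Module.Basis (Fin 4) ℝ V) (i j : Fin 4) (x y : V) :
    dualWedge b i j ![x, y] = b.coord i x * b.coord j y - b.coord j x * b.coord i y := by
  refine (Matrix.det_fin_two
    (fun k : Fin 2 => LinearMap.pi ![b.coord i, b.coord j] (![x, y] k))).trans ?_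
  simp

/-- The component `θᵢⱼ = θ(eᵢ, eⱼ)`, as a linear functional of `θ`. -/
def component (b : Module.Basis (Fin 4) ℝ V) (i j : Fin 4) : TwoForm V →ₗ[ℝ] ℝ where
  toFun θ := θ ![b i, b j]
  map_add' _ _ := rfl
  map_smul' _ _ := rfl

/-- The Hodge operator on two-forms, for the orientation and the neutral metric for which `b` is
an oriented orthonormal basis with `e₁, e₂` timelike and `e₃, e₄` spacelike:
`⋆e¹² = e³⁴`, `⋆e¹³ = e²⁴`, `⋆e¹⁴ = -e²³`, `⋆e²³ = -e¹⁴`, `⋆e²⁴ = e¹³`, `⋆e³⁴ = e¹²`. -/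
def hodge (b : Module.Basis (Fin 4) ℝ V) : TwoForm V →ₗ[ℝ] TwoForm V :=
  (component b 0 1).smulRight (dualWedge b 2 3)
    + (component b 0 2).smulRight (dualWedge b 1 3)
    - (component b 0 3).smulRight (dualWedge b 1 2)
    - (component b 1 2).smulRight (dualWedge b 0 3)
    + (component b 1 3).smulRight (dualWedge b 0 2)
    + (component b 2 3).smulRight (dualWedge b 0 1)

/-- The index pairs `i < j`. -/
def indexPairs : Finset (Fin 4 × Fin 4) := Finset.univ.filter fun p => p.1 < p.2

/-- The inner product induced on two-forms, `⟨φ, θ⟩ = ∑_{i<j} gⁱⁱ gʲʲ φᵢⱼ θᵢⱼ`. -/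
def twoFormInner (b : Module.Basis (Fin 4) ℝ V) (φ θ : TwoForm V) : ℝ :=
  ∑ p ∈ indexPairs, frameSign p.1 * frameSign p.2 * component b p.1 p.2 φ * component b p.1 p.2 θ

/-- The value of the four-form `φ ∧ η` on four vectors. -/
def wedgeApply (φ η : TwoForm V) (x y z w : V) : ℝ :=
  φ ![x, y] * η ![z, w] - φ ![x, z] * η ![y, w] + φ ![x, w] * η ![y, z]
    + φ ![y, z] * η ![x, w] - φ ![y, w] * η ![x, z] + φ ![z, w] * η ![x, y]

/-- The identity `φ ∧ ⋆θ = ⟨φ, θ⟩ e¹ ∧ e² ∧ e³ ∧ e⁴` that characterizes the Hodge operator,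
evaluated on the basis. -/
theorem wedgeApply_hodge (b : Module.Basis (Fin 4) ℝ V) (φ θ : TwoForm V) :
    wedgeApply φ (hodge b θ) (b 0) (b 1) (b 2) (b 3) = twoFormInner b φ θ := by
  have hp : indexPairs = {(0, 1), (0, 2), (0, 3), (1, 2), (1, 3), (2, 3)} := by decide
  rw [twoFormInner, hp]
  simp [wedgeApply, hodge, dualWedge_apply, component, frameSign]
  ring

/-- The anti-self-dual two-forms `Λ⁻ = {θ : ⋆θ = -θ}`. -/
def antiSelfDualForms (b : Module.Basis (Fin 4) ℝ V) : Submodule ℝ (TwoForm V) :=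
  LinearMap.ker (hodge b + LinearMap.id)

/-- The Weyl tensor as an operator on two-forms, computed in an orthonormal basis:
`(W θ)ₖₗ = ∑_{i<j} gⁱⁱ gʲʲ W(eₖ, eₗ, eᵢ, eⱼ) θᵢⱼ`. -/
def weylOperator [FiniteDimensional ℝ V] (M : CurvatureModel V) (b : Module.Basis (Fin 4) ℝ V) :
    TwoForm V →ₗ[ℝ] TwoForm V :=
  ∑ q ∈ indexPairs, (∑ p ∈ indexPairs,
    (frameSign p.1 * frameSign p.2 * M.weyl (b q.1) (b q.2) (b p.1) (b p.2)) •
      component b p.1 p.2).smulRight (dualWedge b q.1 q.2)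

/-- Self-duality for the orientation `o`: the restriction `W⁻` of the Weyl operator to `Λ⁻`
vanishes. The Hodge operator and the Weyl operator do not depend on the choice of the oriented
orthonormal basis in which they are computed. -/
def IsSelfDual [FiniteDimensional ℝ V] (M : CurvatureModel V)
    (o : Orientation ℝ V (Fin 4)) : Prop :=
  ∃ b : Module.Basis (Fin 4) ℝ V, M.IsOrientedFrame o b ∧
    (M.weylOperator b).domRestrict (antiSelfDualForms b) = 0

end

end CurvatureModel

/-
If `x` is null and `⟨x, z⟩ = 1` with `z` null, then `x + (ε r² / 2) z`, rescaled by `1 / r`, runs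
through the quadric `⟨v, v⟩ = ε` while its Jacobi operator blows up like `r⁻² J(x)`. Constant
eigenvalues therefore force `tr J(x)ᵏ = 0` for every null `x` and `k ≥ 1`.

For `k = 1` the Ricci tensor vanishes on the null cone, so the model is Einstein. For `k = 2` write
`V` as a tensor product of two planes, so that the null vectors are the `s ⊗ t`: evaluated in a null
tetrad, `tr J(s ⊗ t)² = 0` says that the product of the self-dual Weyl spinor at `s` and the
anti-self-dual one at `t` is zero. Hence one of these two binary quartics vanishes identically,
which is self-duality for one of the orientations.

Conversely, identify `V` with the split quaternions. If `W⁻ = 0`, the curvature minus its constant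
curvature part acts by left multiplications, and `v ↦ v x` intertwines `J(x)` with `-⟨x, x⟩ J(1)`.
For `⟨x, x⟩ ≠ 0` this map is invertible, so all these `J(x)` are conjugate on each quadric; for null
`x` it yields `J(x)² = 0`.
-/

open Module Filter Topology
open scoped Matrix

theorem norm_trace_pow_le_of_hasEigenvalue {𝕜 W : Type*} [NormedField 𝕜] [IsAlgClosed 𝕜]
    [AddCommGroup W] [Module 𝕜 W] [FiniteDimensional 𝕜 W] {f : End 𝕜 W} {B : ℝ}
    (h : ∀ μ, f.HasEigenvalue μ → ‖μ‖ ≤ B) {k : ℕ} (hk : k ≠ 0) :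
    ‖LinearMap.trace 𝕜 W (f ^ k)‖ ≤ finrank 𝕜 W * B ^ k := by
  have hsplit := IsAlgClosed.splits (f ^ k).charpoly
  rw [End.trace_eq_sum_roots_charpoly_of_splits hsplit, ← LinearMap.charpoly_natDegree (f ^ k),
    hsplit.natDegree_eq_card_roots, ← Multiset.card_map (‖·‖), ← nsmul_eq_mul]
  refine (norm_multiset_sum_le _).trans (Multiset.sum_le_card_nsmul _ _ fun _ hr => ?_)
  obtain ⟨μ, hμ, rfl⟩ := Multiset.mem_map.1 hr
  have hspec : μ ∈ spectrum 𝕜 (f ^ k) := End.hasEigenvalue_iff_mem_spectrum.1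
    ((End.hasEigenvalue_iff_isRoot_charpoly _ _).2 (Polynomial.isRoot_of_mem_roots hμ))
  rw [spectrum.map_pow_of_pos f (Nat.pos_of_ne_zero hk)] at hspec
  obtain ⟨ν, hν, rfl⟩ := hspec
  rw [norm_pow]
  gcongr
  exact h ν (End.hasEigenvalue_iff_mem_spectrum.2 hν)

namespace CurvatureModel

noncomputable section

variable {V : Type*} [AddCommGroup V] [Module ℝ V]

section Symmetries

variable (M : CurvatureModel V)

theorem form_comm (x y : V) : M.form x y = M.form y x := by
  simpa using M.form_symm.eq x y

theorem ext_form {u v : V} (h : ∀ w, M.form u w = M.form v w) : u = v :=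
  sub_eq_zero.1 <| M.form_nondegenerate.1 (u - v) fun w => by simp [h w]

theorem A_antisymm_right (x y z v : V) : M.A x y z v = -M.A x y v z := by
  rw [M.A_pair_symm, M.A_antisymm, M.A_pair_symm]

theorem A_self_left (x z v : V) : M.A x x z v = 0 := by
  linarith [M.A_antisymm x x z v]

theorem A_self_right (x y z : V) : M.A x y z z = 0 := by
  linarith [M.A_antisymm_right x y z z]

theorem A_reverse (x y z v : V) : M.A x y z v = M.A v z y x := by
  rw [M.A_pair_symm, M.A_antisymm, M.A_antisymm_right, neg_neg]

theorem exists_null_dual {x : V} (hx : M.form x x = 0) (hx0 : x ≠ 0) :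
    ∃ z, M.form z z = 0 ∧ M.form x z = 1 := by
  obtain ⟨w, hw⟩ : ∃ w, M.form x w ≠ 0 := by
    by_contra! hc
    exact hx0 (M.form_nondegenerate.1 x hc)
  set u := (M.form x w)⁻¹ • w
  have hxu : M.form x u = 1 := by simp [u, hw]
  refine ⟨u - (M.form u u / 2) • x, ?_, by simp [hx, hxu]⟩
  simp [hx, hxu, M.form_comm u x]
  ring

/-- The nonzero vectors of square `ε`: the unit pseudospheres for `ε = ±1` and the null cone for
`ε = 0`. -/
def quadric (ε : ℝ) : Set V := {x | x ≠ 0 ∧ M.form x x = ε}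

theorem quadric_eq_of_ne_zero {ε : ℝ} (hε : ε ≠ 0) : M.quadric ε = {x | M.form x x = ε} := by
  ext x
  refine and_iff_right_of_imp ?_
  rintro hx rfl
  exact hε (by simpa using hx.symm)

theorem spacelikeUnit_eq_quadric : M.spacelikeUnit = M.quadric 1 :=
  (M.quadric_eq_of_ne_zero one_ne_zero).symm

theorem timelikeUnit_eq_quadric : M.timelikeUnit = M.quadric (-1) :=
  (M.quadric_eq_of_ne_zero (by norm_num)).symm

end Symmetries

section Jacobi

variable [FiniteDimensional ℝ V] {M : CurvatureModel V}

variable (M) in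
theorem form_jacobi (x y z : V) : M.form (M.jacobi x y) z = M.A y x x z := M.form_curv x x y z

variable (M) in
theorem jacobi_smul (r : ℝ) (x : V) : M.jacobi (r • x) = r ^ 2 • M.jacobi x := by
  ext y
  refine M.ext_form fun w => ?_
  simp only [form_jacobi, map_smul, LinearMap.smul_apply, smul_eq_mul]
  ring

variable (M) in
theorem jacobi_add_smul (x z : V) (t : ℝ) :
    M.jacobi (x + t • z) = M.jacobi x + t • (M.curv x z + M.curv z x) + t ^ 2 • M.jacobi z := by
  ext y
  refine M.ext_form fun w => ?_
  simp only [form_jacobi, form_curv, map_add, map_smul, LinearMap.add_apply,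
    LinearMap.smul_apply, smul_eq_mul]
  ring

variable (M) in
theorem continuous_trace_jacobi_pow (x z : V) (k : ℕ) :
    Continuous fun t : ℝ => LinearMap.trace ℝ V (M.jacobi (x + t • z) ^ k) := by
  simp only [LinearMap.trace_eq_matrix_trace ℝ (finBasis ℝ V), ← LinearMap.toMatrix_pow,
    jacobi_add_smul, map_add, map_smul]
  fun_prop

theorem JordanOssermanOn.ossermanOn {S : Set V} (h : M.JordanOssermanOn S) : M.OssermanOn S := by
  intro x hx y hy
  obtain ⟨e, he⟩ := h x hx y hy
  ext μ
  simp only [jacobiEigenvalues, Set.mem_ofPred_eq, End.hasEigenvalue_iff_isRoot_charpoly,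
    LinearMap.charpoly_baseChange]
  rw [← he, LinearEquiv.charpoly_conj]

theorem jacobiEigenvalues_eq_zero_of_isNilpotent {x : V} (hx : x ≠ 0)
    (h : IsNilpotent (M.jacobi x)) : M.jacobiEigenvalues x = {0} := by
  have : Nontrivial V := ⟨x, 0, hx⟩
  ext μ
  rw [jacobiEigenvalues, Set.mem_ofPred_eq, End.hasEigenvalue_iff_isRoot_charpoly,
    LinearMap.charpoly_baseChange, h.charpoly_eq_X_pow_finrank]
  simp [finrank_pos.ne']

theorem OssermanOn.exists_trace_bound {S : Set V} (h : M.OssermanOn S) {k : ℕ} (hk : k ≠ 0) :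
    ∃ B : ℝ, ∀ x ∈ S, |LinearMap.trace ℝ V (M.jacobi x ^ k)| ≤ B := by
  rcases S.eq_empty_or_nonempty with rfl | ⟨x₀, hx₀⟩
  · exact ⟨0, by simp⟩
  obtain ⟨B, hB⟩ : BddAbove ((‖·‖) '' M.jacobiEigenvalues x₀) :=
    ((End.finite_hasEigenvalue _).image _).bddAbove
  refine ⟨finrank ℝ V * B ^ k, fun x hx => ?_⟩
  have hle : ∀ μ ∈ M.jacobiEigenvalues x, ‖μ‖ ≤ B := fun μ hμ =>
    hB ⟨μ, h x hx x₀ hx₀ ▸ hμ, rfl⟩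
  have := norm_trace_pow_le_of_hasEigenvalue hle hk
  rwa [← LinearMap.baseChange_pow, LinearMap.trace_baseChange, norm_algebraMap', finrank_baseChange]
    at this

theorem OssermanOn.trace_jacobi_pow_eq_zero {ε : ℝ} (h : M.OssermanOn (M.quadric ε)) {x : V}
    (hx : M.form x x = 0) {k : ℕ} (hk : k ≠ 0) : LinearMap.trace ℝ V (M.jacobi x ^ k) = 0 := by
  rcases eq_or_ne x 0 with rfl | hx0
  · have : M.jacobi 0 = 0 := by simpa using M.jacobi_smul 0 0
    simp [this, hk]
  obtain ⟨z, hz, hxz⟩ := M.exists_null_dual hx hx0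
  obtain ⟨B, hB⟩ := h.exists_trace_bound hk
  set path : ℝ → V := fun r => x + (ε * r ^ 2 / 2) • z
  set p : ℝ → ℝ := fun r => LinearMap.trace ℝ V (M.jacobi (path r) ^ k)
  have hmem : ∀ r ≠ 0, r⁻¹ • path r ∈ M.quadric ε := by
    refine fun r hr => ⟨fun h0 => ?_, ?_⟩
    · have : M.form (r⁻¹ • path r) z = 0 := by rw [h0]; simp
      simp [path, hz, hxz, hr] at this
    · simp [path, hx, hz, hxz, M.form_comm z x]
      field
  have hbound : ∀ r ≠ 0, ‖p r‖ ≤ r ^ (2 * k) * B := by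
    intro r hr
    have hscale : M.jacobi (path r) = r ^ 2 • M.jacobi (r⁻¹ • path r) := by
      rw [← jacobi_smul, smul_inv_smul₀ hr]
    simp only [p]
    rw [hscale, smul_pow, map_smul, norm_smul, ← pow_mul,
      Real.norm_of_nonneg ((even_two_mul k).pow_nonneg r)]
    exact mul_le_mul_of_nonneg_left (hB _ (hmem r hr)) ((even_two_mul k).pow_nonneg r)
  have hp : Tendsto p (𝓝[≠] 0) (𝓝 (p 0)) :=
    (((M.continuous_trace_jacobi_pow x z k).comp (by fun_prop :
      Continuous fun r : ℝ => ε * r ^ 2 / 2)).tendsto 0).mono_left nhdsWithin_le_nhds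
  have hzero : Tendsto (fun r : ℝ => r ^ (2 * k) * B) (𝓝[≠] 0) (𝓝 0) := by
    have : Continuous fun r : ℝ => r ^ (2 * k) * B := by fun_prop
    simpa [hk] using (this.tendsto 0).mono_left nhdsWithin_le_nhds
  have := tendsto_nhds_unique hp (squeeze_zero_norm' (eventually_mem_nhdsWithin.mono hbound) hzero)
  simpa [p, path] using this

end Jacobi

section NullVanishing

variable {M : CurvatureModel V} {B : LinearMap.BilinForm ℝ V}

theorem apply_eq_zero_of_forall_null (hB : B.IsSymm) (hnull : ∀ x, M.form x x = 0 → B x x = 0)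
    {p q w : V} (hp : M.form p p = 0) (hq : M.form q q = 0) (hpq : M.form p q = 1)
    (hBpq : B p q = 0) (hpw : M.form p w = 0) (hqw : M.form q w = 0) :
    B p w = 0 ∧ B w w = 0 := by
  have hBcomm (x y : V) : B x y = B y x := by simpa using hB.eq x y
  have hcurve (t : ℝ) : 2 * t * B p w + t ^ 2 * B w w - t ^ 3 * M.form w w * B q w = 0 := by
    have := hnull (p + t • w - (t ^ 2 * M.form w w / 2) • q) (by
      simp [hp, hq, hpq, hpw, hqw, M.form_comm w p, M.form_comm w q, M.form_comm q p]
      ring)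
    simp [hnull p hp, hnull q hq, hBpq, hBcomm w p, hBcomm w q, hBcomm q p] at this
    linear_combination this
  constructor <;> linarith [hcurve 1, hcurve (-1), hcurve 2]

theorem eq_smul_form_of_forall_null (hB : B.IsSymm) (hnull : ∀ x, M.form x x = 0 → B x x = 0)
    {p q : V} (hp : M.form p p = 0) (hq : M.form q q = 0) (hpq : M.form p q = 1) :
    B = B p q • M.form := by
  set C := B - B p q • M.form with hC
  have hCsymm : C.IsSymm := hB.sub (M.form_symm.smul _)
  have hCcomm (x y : V) : C x y = C y x := by simpa using hCsymm.eq x y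
  have hCnull : ∀ x, M.form x x = 0 → C x x = 0 := fun x hx => by simp [hC, hx, hnull x hx]
  have hCpq : C p q = 0 := by simp [hC, hpq]
  suffices C = 0 from sub_eq_zero.1 this
  refine LinearMap.BilinForm.ext_of_isSymm hCsymm LinearMap.BilinForm.isSymm_zero fun x => ?_
  set w := x - M.form x q • p - M.form x p • q with hw
  have hpw : M.form p w = 0 := by simp [hw, hp, hpq, M.form_comm x]
  have hqw : M.form q w = 0 := by simp [hw, hq, hpq, M.form_comm x, M.form_comm q p]
  obtain ⟨hCpw, hCww⟩ := apply_eq_zero_of_forall_null hCsymm hCnull hp hq hpq hCpq hpw hqw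
  have hCqw : C q w = 0 := (apply_eq_zero_of_forall_null hCsymm hCnull hq hp
    (by rw [form_comm, hpq]) (by rw [hCcomm, hCpq]) hqw hpw).1
  have hx : x = M.form x q • p + M.form x p • q + w := by rw [hw]; abel
  rw [hx]
  simp only [map_add, map_smul, LinearMap.add_apply, LinearMap.smul_apply, LinearMap.zero_apply,
    smul_eq_mul, hCnull p hp, hCnull q hq, hCcomm q p, hCpq, hCcomm w p, hCpw, hCcomm w q, hCqw,
    hCww, mul_zero, add_zero]

end NullVanishing

section Ricci

variable [FiniteDimensional ℝ V] (M : CurvatureModel V)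

theorem ricci_apply (x y : V) : M.ricci x y = LinearMap.trace ℝ V (M.curv x y) := rfl

theorem ricci_comm (x y : V) : M.ricci x y = M.ricci y x := by
  have hadj : (M.form.toDual M.form_nondegenerate).conj (M.curv y x)
      = Module.Dual.transpose (M.curv x y) := by
    rw [LinearEquiv.conj_apply, LinearEquiv.comp_toLinearMap_symm_eq]
    ext z w
    simp only [LinearMap.comp_apply, LinearEquiv.coe_coe, LinearMap.BilinForm.toDual_def,
      Module.Dual.transpose_apply, form_curv]
    rw [form_comm, form_curv, A_reverse]
  rw [ricci_apply, ricci_apply, ← LinearMap.trace_transpose', ← hadj, LinearMap.trace_conj']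

variable {M}

theorem isEinstein_of_trace_jacobi_eq_zero {p : V} (hp : M.form p p = 0) (hp0 : p ≠ 0)
    (h : ∀ x, M.form x x = 0 → LinearMap.trace ℝ V (M.jacobi x) = 0) : M.IsEinstein := by
  obtain ⟨q, hq, hpq⟩ := M.exists_null_dual hp hp0
  have hsymm : M.ricci.IsSymm := ⟨fun x y => M.ricci_comm x y⟩
  exact ⟨M.ricci p q, fun x y =>
    LinearMap.congr_fun₂ (eq_smul_form_of_forall_null hsymm h hp hq hpq) x y⟩

end Ricci

section Concircular

variable (M : CurvatureModel V)

/-- The model whose curvature tensor is `A` minus `k` times the tensor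
`⟨y, z⟩⟨x, v⟩ - ⟨x, z⟩⟨y, v⟩` of constant sectional curvature one. For an Einstein model with
`ρ = k (dim V - 1) ⟨·,·⟩` this is the concircular curvature tensor, which is Ricci-flat and
coincides with the Weyl tensor. -/
def concircular (k : ℝ) : CurvatureModel V where
  __ := M
  A := LinearMap.mk₂ ℝ
    (fun x y => M.A x y - k • (LinearMap.BilinForm.linMulLin (M.form y) (M.form x)
      - LinearMap.BilinForm.linMulLin (M.form x) (M.form y)))
    (fun x x' y => by ext; simp; ring)
    (fun c x y => by ext; simp; ring)
    (fun x y y' => by ext; simp; ring)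
    (fun c x y => by ext; simp; ring)
  A_antisymm x y z v := by
    simp [M.A_antisymm x y]
    ring
  A_pair_symm x y z v := by
    simp only [LinearMap.mk₂_apply, LinearMap.sub_apply, LinearMap.smul_apply,
      LinearMap.BilinForm.linMulLin_apply, smul_eq_mul, M.form_comm v x, M.form_comm z y,
      M.form_comm z x, M.form_comm v y]
    linear_combination M.A_pair_symm x y z v
  A_bianchi x y z v := by
    simp only [LinearMap.mk₂_apply, LinearMap.sub_apply, LinearMap.smul_apply,
      LinearMap.BilinForm.linMulLin_apply, smul_eq_mul]
    linear_combination M.A_bianchi x y z v - k * (M.form_comm y z * M.form x v +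
      M.form_comm z x * M.form y v + M.form_comm x y * M.form z v)

theorem form_concircular (k : ℝ) : (M.concircular k).form = M.form := rfl

theorem A_concircular (k : ℝ) (x y z v : V) : (M.concircular k).A x y z v =
    M.A x y z v - k * (M.form y z * M.form x v - M.form x z * M.form y v) := by
  simp [concircular]

variable [FiniteDimensional ℝ V]

theorem curv_concircular (k : ℝ) (x y : V) : (M.concircular k).curv x y =
    M.curv x y - k • (M.form x y • LinearMap.id - (M.form y).smulRight x) := by
  ext z
  refine M.ext_form fun w => ?_
  rw [← form_concircular M k, form_curv, A_concircular]
  simp [form_concircular, form_curv, M.form_comm y z]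

theorem jacobi_concircular (k : ℝ) (x y : V) : (M.concircular k).jacobi x y =
    M.jacobi x y - k • (M.form x x • y - M.form x y • x) := by
  simp [jacobi, curv_concircular]

theorem ricci_concircular (k : ℝ) (x y : V) : (M.concircular k).ricci x y =
    M.ricci x y - k * (finrank ℝ V - 1) * M.form x y := by
  simp only [ricci_apply, curv_concircular, map_sub, map_smul, LinearMap.trace_id,
    LinearMap.trace_smulRight, smul_eq_mul, M.form_comm y x]
  ring

variable {M}

theorem scalar_of_ricci_eq {c : ℝ} (h : ∀ x y, M.ricci x y = c * M.form x y) :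
    M.scalar = c * finrank ℝ V := by
  have : M.raise M.ricci = c • LinearMap.id := by
    ext y
    refine M.ext_form fun w => ?_
    simp [form_raise, h]
  rw [scalar, this, map_smul, LinearMap.trace_id, smul_eq_mul]

theorem weyl_eq_A_concircular (hdim : finrank ℝ V = 4) {k : ℝ}
    (h : ∀ x y, M.ricci x y = 3 * k * M.form x y) (x y z v : V) :
    M.weyl x y z v = (M.concircular k).A x y z v := by
  rw [weyl, scalar_of_ricci_eq h, hdim, A_concircular]
  simp only [h]
  push_cast
  ring

end Concircular

section DualFamily

variable {M : CurvatureModel V} {ι : Type*} [DecidableEq ι]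

theorem repr_eq_of_dual {b : Basis ι ℝ V} {b' : ι → V}
    (h : ∀ i j, M.form (b i) (b' j) = if i = j then 1 else 0) (v : V) (i : ι) :
    b.repr v i = M.form v (b' i) := by
  have hcoord : b.coord i = M.form.flip (b' i) := b.ext fun j => by
    simp [h, Finsupp.single_apply]
  exact LinearMap.congr_fun hcoord v

variable [Fintype ι]

theorem form_eq_sum_of_dual {b : Basis ι ℝ V} {b' : ι → V}
    (h : ∀ i j, M.form (b i) (b' j) = if i = j then 1 else 0) (v w : V) :
    M.form v w = ∑ i, M.form v (b' i) * M.form (b i) w := by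
  conv_lhs => rw [← b.sum_repr v]
  simp only [map_sum, map_smul, LinearMap.sum_apply, LinearMap.smul_apply, smul_eq_mul,
    repr_eq_of_dual h]

theorem trace_eq_sum_of_dual {b : Basis ι ℝ V} {b' : ι → V}
    (h : ∀ i j, M.form (b i) (b' j) = if i = j then 1 else 0) (f : End ℝ V) :
    LinearMap.trace ℝ V f = ∑ i, M.form (f (b i)) (b' i) := by
  simp [LinearMap.trace_eq_matrix_trace ℝ b, Matrix.trace, LinearMap.toMatrix_apply,
    repr_eq_of_dual h]

theorem exists_basis_of_dual [FiniteDimensional ℝ V] {b b' : ι → V}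
    (h : ∀ i j, M.form (b i) (b' j) = if i = j then 1 else 0)
    (hcard : Fintype.card ι = finrank ℝ V) : ∃ e : Basis ι ℝ V, ⇑e = b := by
  have hli : LinearIndependent ℝ b :=
    LinearIndependent.of_pairwise_dual_eq_zero_one b (fun i => M.form.flip (b' i))
      (fun i j hij => by simp [h, hij.symm]) (fun i => by simp [h])
  rcases isEmpty_or_nonempty ι with hι | hι
  · have : Subsingleton V := finrank_zero_iff.1 (by rw [← hcard, Fintype.card_eq_zero])
    exact ⟨Basis.empty V, Subsingleton.elim _ _⟩
  · exact ⟨basisOfLinearIndependentOfCardEqFinrank hli hcard, by simp⟩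

end DualFamily

section NullTetrad

variable [FiniteDimensional ℝ V] {M : CurvatureModel V}

theorem A_mul_A_eq_zero_of_nullTetrad (hdim : finrank ℝ V = 4) {x y u v : V}
    (h : ∀ i j, M.form (![x, y, u, v] i) (![y, x, v, u] j) = if i = j then 1 else 0)
    (htr : LinearMap.trace ℝ V (M.jacobi x) = 0)
    (htr_sq : LinearMap.trace ℝ V (M.jacobi x ^ 2) = 0) :
    M.A u x x u * M.A v x x v = 0 := by
  obtain ⟨e, he⟩ := exists_basis_of_dual h (by simp [hdim])
  rw [← he] at h
  have hsymm (z w : V) : M.form (M.jacobi x z) w = M.form (M.jacobi x w) z := by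
    rw [form_jacobi, form_jacobi, A_reverse]
  have hx_right (z : V) : M.form (M.jacobi x z) x = 0 := by rw [form_jacobi, A_self_right]
  have hJx : M.jacobi x x = 0 := M.ext_form fun w => by simp [form_jacobi, A_self_left]
  have hsq (z w : V) : M.form ((M.jacobi x ^ 2) z) w = M.form (M.jacobi x z) (M.jacobi x w) := by
    rw [pow_two, Module.End.mul_apply, hsymm, form_comm]
  have huv : M.form (M.jacobi x u) v = 0 := by
    rw [trace_eq_sum_of_dual h, Fin.sum_univ_four, he] at htr
    simp only [Matrix.cons_val, hJx, hx_right, hsymm v u, map_zero, LinearMap.zero_apply] at htr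
    linarith
  have hJJ : M.form (M.jacobi x u) (M.jacobi x v) = 0 := by
    rw [trace_eq_sum_of_dual h, Fin.sum_univ_four, he] at htr_sq
    simp only [Matrix.cons_val, hsq, hJx, map_zero, LinearMap.zero_apply,
      M.form_comm (M.jacobi x v)] at htr_sq
    linarith
  rw [form_eq_sum_of_dual h, Fin.sum_univ_four, he] at hJJ
  simp only [Matrix.cons_val, hx_right, huv, M.form_comm x, M.form_comm v] at hJJ
  simpa [form_jacobi] using hJJ

end NullTetrad

section Frame

variable (M : CurvatureModel V)

theorem exists_orthonormal_basis [FiniteDimensional ℝ V] :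
    ∃ (w : Fin (finrank ℝ V) → ℝ) (b : Basis (Fin (finrank ℝ V)) ℝ V),
      (∀ i, w i = -1 ∨ w i = 1) ∧ {i | w i < 0}.ncard = sigNeg M.form.toQuadraticMap ∧
      ∀ i j, M.form (b i) (b j) = if i = j then w i else 0 := by
  have hassoc : QuadraticMap.associated (R := ℝ) M.form.toQuadraticMap = M.form :=
    QuadraticMap.associated_left_inverse ℝ M.form_comm
  obtain ⟨w, hw, he⟩ := QuadraticForm.equivalent_one_neg_one_weighted_sum_squared
    M.form.toQuadraticMap (by rw [hassoc]; exact M.form_nondegenerate.1)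
  have hneg := QuadraticForm.sigNeg_of_equiv_weightedSumSquares he
  obtain ⟨e⟩ := he
  refine ⟨w, (Pi.basisFun ℝ _).map e.toLinearEquiv.symm, hw, hneg.symm, fun i j => ?_⟩
  have hform (x y : Fin (finrank ℝ V) → ℝ) :
      M.form (e.symm x) (e.symm y) = ∑ k, w k * (x k * y k) := by
    have hsq (z : Fin (finrank ℝ V) → ℝ) :
        M.form (e.symm z) (e.symm z) = ∑ k, w k * (z k * z k) := by
      simpa only [QuadraticMap.weightedSumSquares_apply, smul_eq_mul,
        LinearMap.BilinMap.toQuadraticMap_apply] using e.symm.map_app z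
    have hadd : e.symm (x + y) = e.symm x + e.symm y := map_add e.symm.toLinearEquiv x y
    have hpolar := hsq (x + y)
    simp only [hadd, map_add, LinearMap.add_apply, hsq, M.form_comm (e.symm y), Pi.add_apply,
      mul_add, add_mul, Finset.sum_add_distrib, mul_comm (y _)] at hpolar
    linarith
  simp only [Basis.map_apply, Pi.basisFun_apply]
  refine (hform _ _).trans ?_
  rcases eq_or_ne i j with rfl | hij <;> simp [Pi.single_apply, eq_comm, *]

theorem exists_perm_apply_eq_frameSign {w : Fin 4 → ℝ} (hw : ∀ i, w i = -1 ∨ w i = 1)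
    (hneg : {i | w i < 0}.ncard = 2) : ∃ σ : Equiv.Perm (Fin 4), ∀ i, w (σ i) = frameSign i := by
  have hperm : ∀ s : Finset (Fin 4), s.card = 2 →
      ∃ σ : Equiv.Perm (Fin 4), ∀ i, σ i ∈ s ↔ i = 0 ∨ i = 1 := by decide
  obtain ⟨σ, hσ⟩ := hperm (Finset.univ.filter fun i => w i < 0) (by
    rw [← hneg, Set.ncard_eq_toFinset_card', Set.toFinset_ofPred])
  simp only [Finset.mem_filter_univ] at hσ
  refine ⟨σ, fun i => ?_⟩
  have hwi : w (σ i) = if i = 0 ∨ i = 1 then -1 else 1 := by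
    rw [← if_congr (hσ i) rfl rfl]
    rcases hw (σ i) with h | h <;> norm_num [h]
  rw [hwi]
  fin_cases i <;> simp [frameSign]

/-- `b` is an orthonormal basis `e₁, e₂, e₃, e₄` with `e₁, e₂` timelike and `e₃, e₄` spacelike. -/
def IsFrame (b : Basis (Fin 4) ℝ V) : Prop :=
  ∀ i j, M.form (b i) (b j) = if i = j then frameSign i else 0

variable {M}

theorem IsNeutral.exists_isFrame [FiniteDimensional ℝ V] (hM : M.IsNeutral) : ∃ b, M.IsFrame b := by
  obtain ⟨hdim, -, hneg⟩ := hM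
  obtain ⟨w, b, hw, hcard, hb⟩ := M.exists_orthonormal_basis
  rw [hneg] at hcard
  clear hneg
  revert w b
  rw [hdim]
  intro w b hw hcard hb
  obtain ⟨σ, hσ⟩ := exists_perm_apply_eq_frameSign hw hcard
  exact ⟨b.reindex σ.symm, fun i j => by simp [hb, hσ]⟩

end Frame

section TwoForms

variable (b : Basis (Fin 4) ℝ V)

theorem sum_indexPairs {N : Type*} [AddCommMonoid N] (f : Fin 4 × Fin 4 → N) :
    ∑ p ∈ indexPairs, f p =
      f (0, 1) + f (0, 2) + f (0, 3) + f (1, 2) + f (1, 3) + f (2, 3) := by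
  have hp : indexPairs = {(0, 1), (0, 2), (0, 3), (1, 2), (1, 3), (2, 3)} := by decide
  rw [hp]
  simp [add_assoc]

theorem component_apply (k l : Fin 4) (θ : TwoForm V) : component b k l θ = θ ![b k, b l] := rfl

theorem component_swap (k l : Fin 4) (θ : TwoForm V) : component b l k θ = -component b k l θ := by
  have hswap : ![b k, b l] ∘ ⇑(Equiv.swap (0 : Fin 2) 1) = ![b l, b k] := by
    ext i; fin_cases i <;> simp
  simpa only [component_apply, hswap] using θ.map_swap ![b k, b l] zero_ne_one

theorem twoForm_ext {θ η : TwoForm V}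
    (h : ∀ k l : Fin 4, k < l → component b k l θ = component b k l η) : θ = η := by
  refine Basis.ext_alternating b fun v hv => ?_
  have hb : (fun i => b (v i)) = ![b (v 0), b (v 1)] := by
    ext i; fin_cases i <;> simp
  rw [hb, ← component_apply, ← component_apply]
  rcases lt_or_gt_of_ne (hv.ne zero_ne_one) with hlt | hgt
  · exact h _ _ hlt
  · rw [component_swap, h _ _ hgt, ← component_swap]

theorem component_dualWedge (i j k l : Fin 4) : component b k l (dualWedge b i j) =
    (if k = i then 1 else 0) * (if l = j then 1 else 0)
      - (if k = j then 1 else 0) * (if l = i then 1 else 0) := by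
  simpa [component_apply, Finsupp.single_apply] using dualWedge_apply b i j (b k) (b l)

theorem mem_antiSelfDualForms_iff (θ : TwoForm V) :
    θ ∈ antiSelfDualForms b ↔ component b 2 3 θ = -component b 0 1 θ ∧
      component b 1 3 θ = -component b 0 2 θ ∧ component b 1 2 θ = component b 0 3 θ := by
  have hzero : θ ∈ antiSelfDualForms b ↔
      ∀ k l : Fin 4, k < l → component b k l (hodge b θ) + component b k l θ = 0 := by
    rw [antiSelfDualForms, LinearMap.mem_ker]
    exact ⟨fun h k l _ => by simpa using congrArg (component b k l) h,
      fun h => twoForm_ext b fun k l hkl => by simpa using h k l hkl⟩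
  rw [hzero]
  simp only [Fin.forall_fin_succ, Fin.forall_fin_zero, hodge, component_dualWedge,
    LinearMap.add_apply, LinearMap.sub_apply, LinearMap.smulRight_apply, map_add, map_sub,
    map_smul, smul_eq_mul]
  simp only [lt_self_iff_false, Fin.isValue, Fin.reduceEq, ↓reduceIte, mul_zero, sub_self,
    zero_ne_one, add_zero, mul_one, zero_add, IsEmpty.forall_iff, Fin.succ_zero_eq_one, zero_lt_one,
    one_ne_zero, sub_zero, forall_const, Fin.succ_one_eq_two, Fin.reduceLT, Fin.reduceSucc,
    zero_sub, and_true, true_and, not_lt_zero, mul_neg, Fin.lt_one_iff, Nat.reduceAdd,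
    sub_neg_eq_add, and_self]
  grind

section WeylOperator

variable [FiniteDimensional ℝ V] (M : CurvatureModel V)

theorem component_weylOperator {k l : Fin 4} (hkl : k < l) (θ : TwoForm V) :
    component b k l (M.weylOperator b θ) = ∑ p ∈ indexPairs, frameSign p.1 * frameSign p.2 *
      M.weyl (b k) (b l) (b p.1) (b p.2) * component b p.1 p.2 θ := by
  have hdual : ∀ q ∈ indexPairs, component b k l (dualWedge b q.1 q.2) =
      if q = (k, l) then 1 else 0 := by
    rintro ⟨i, j⟩ hq
    have hij : i < j := by simpa [indexPairs] using hq
    have hne : ¬(k = j ∧ l = i) := by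
      rintro ⟨rfl, rfl⟩
      exact lt_asymm hij hkl
    rw [component_dualWedge, ite_zero_mul_ite_zero, ite_zero_mul_ite_zero, if_neg hne]
    simp [eq_comm]
  rw [weylOperator, LinearMap.sum_apply, map_sum]
  simp only [LinearMap.smulRight_apply, map_smul, smul_eq_mul]
  rw [Finset.sum_congr rfl fun q hq => by rw [hdual q hq]]
  simp [indexPairs, hkl]

theorem component_weylOperator_of_mem {k l : Fin 4} (hkl : k < l) {θ : TwoForm V}
    (hθ : θ ∈ antiSelfDualForms b) : component b k l (M.weylOperator b θ) =
      (M.weyl (b k) (b l) (b 0) (b 1) - M.weyl (b k) (b l) (b 2) (b 3)) * component b 0 1 θ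
      - (M.weyl (b k) (b l) (b 0) (b 2) - M.weyl (b k) (b l) (b 1) (b 3)) * component b 0 2 θ
      - (M.weyl (b k) (b l) (b 0) (b 3) + M.weyl (b k) (b l) (b 1) (b 2)) * component b 0 3 θ := by
  obtain ⟨h23, h13, h12⟩ := (mem_antiSelfDualForms_iff b θ).1 hθ
  rw [component_weylOperator b M hkl, sum_indexPairs, h23, h13, h12]
  simp only [frameSign, Matrix.cons_val]
  ring

theorem domRestrict_weylOperator_eq_zero_iff :
    (M.weylOperator b).domRestrict (antiSelfDualForms b) = 0 ↔ ∀ k l : Fin 4, k < l →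
      M.weyl (b k) (b l) (b 0) (b 1) - M.weyl (b k) (b l) (b 2) (b 3) = 0 ∧
      M.weyl (b k) (b l) (b 0) (b 2) - M.weyl (b k) (b l) (b 1) (b 3) = 0 ∧
      M.weyl (b k) (b l) (b 0) (b 3) + M.weyl (b k) (b l) (b 1) (b 2) = 0 := by
  have hmem : (M.weylOperator b).domRestrict (antiSelfDualForms b) = 0 ↔
      ∀ θ ∈ antiSelfDualForms b, M.weylOperator b θ = 0 := by
    simp [LinearMap.ext_iff]
  rw [hmem]
  constructor
  · intro h k l hkl
    have hzero {θ : TwoForm V} (hθ : θ ∈ antiSelfDualForms b) := by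
      simpa only [h θ hθ, map_zero] using component_weylOperator_of_mem b M hkl hθ
    have h01 := hzero (θ := dualWedge b 0 1 - dualWedge b 2 3) (by
      rw [mem_antiSelfDualForms_iff]; simp [component_dualWedge])
    have h02 := hzero (θ := dualWedge b 0 2 - dualWedge b 1 3) (by
      rw [mem_antiSelfDualForms_iff]; simp [component_dualWedge])
    have h03 := hzero (θ := dualWedge b 0 3 + dualWedge b 1 2) (by
      rw [mem_antiSelfDualForms_iff]; simp [component_dualWedge])
    simp only [map_add, map_sub, component_dualWedge, Fin.isValue, Fin.reduceEq, ↓reduceIte,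
      zero_ne_one, one_ne_zero, mul_one, mul_zero, sub_zero, sub_self, zero_sub, add_zero]
      at h01 h02 h03
    exact ⟨by linarith, by linarith, by linarith⟩
  · intro h θ hθ
    refine twoForm_ext b fun k l hkl => ?_
    obtain ⟨h1, h2, h3⟩ := h k l hkl
    rw [component_weylOperator_of_mem b M hkl hθ, h1, h2, h3]
    simp

end WeylOperator

end TwoForms

section ASD

theorem bilin_eq_zero_of_isAlt {ι : Type*} [LinearOrder ι] (b : Basis ι ℝ V)
    {B : LinearMap.BilinForm ℝ V} (hB : B.IsAlt) (h : ∀ k l, k < l → B (b k) (b l) = 0) :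
    B = 0 := by
  refine LinearMap.BilinForm.ext_basis b fun k l => ?_
  rcases lt_trichotomy k l with hkl | rfl | hlk
  · exact h k l hkl
  · exact hB (b k)
  · rw [← hB.neg_eq, h l k hlk, neg_zero, LinearMap.zero_apply, LinearMap.zero_apply]

/-- The values of a two-form `f` on the bivectors `e₁ ∧ e₂ - e₃ ∧ e₄`, `e₁ ∧ e₃ - e₂ ∧ e₄` and
`e₁ ∧ e₄ + e₂ ∧ e₃`, which span the anti-self-dual bivectors when `b` is an oriented orthonormal
basis. The form may take its values in any group, so that it applies to each pair of arguments of a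
curvature tensor. -/
def asdPart {V X : Type*} [AddGroup X] (b : Fin 4 → V) (f : V → V → X) : Fin 3 → X :=
  ![f (b 0) (b 1) - f (b 2) (b 3), f (b 0) (b 2) - f (b 1) (b 3), f (b 0) (b 3) + f (b 1) (b 2)]

theorem asdPart_eq_zero_iff {V X : Type*} [AddGroup X] {b : Fin 4 → V} {f : V → V → X} :
    asdPart b f = 0 ↔ f (b 0) (b 1) - f (b 2) (b 3) = 0 ∧
      f (b 0) (b 2) - f (b 1) (b 3) = 0 ∧ f (b 0) (b 3) + f (b 1) (b 2) = 0 := by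
  simp [asdPart, funext_iff, Fin.forall_fin_succ]

variable (M : CurvatureModel V)

theorem asdPart_A_eq_zero_of_basis (b : Basis (Fin 4) ℝ V)
    (h : ∀ k l, k < l → asdPart b (M.A (b k) (b l) · ·) = 0) (x y : V) :
    asdPart b (M.A x y · ·) = 0 := by
  have hpair (k l) (hkl : k < l) := by
    simpa only [M.A_pair_symm (b k) (b l)] using asdPart_eq_zero_iff.1 (h k l hkl)
  refine asdPart_eq_zero_iff.2 ⟨?_, ?_, ?_⟩ <;> rw [M.A_pair_symm x y, M.A_pair_symm x y]
  · exact LinearMap.congr_fun₂ (bilin_eq_zero_of_isAlt b (B := M.A (b 0) (b 1) - M.A (b 2) (b 3))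
      (fun z => by simp [A_self_right]) fun k l hkl => (hpair k l hkl).1) x y
  · exact LinearMap.congr_fun₂ (bilin_eq_zero_of_isAlt b (B := M.A (b 0) (b 2) - M.A (b 1) (b 3))
      (fun z => by simp [A_self_right]) fun k l hkl => (hpair k l hkl).2.1) x y
  · exact LinearMap.congr_fun₂ (bilin_eq_zero_of_isAlt b (B := M.A (b 0) (b 3) + M.A (b 1) (b 2))
      (fun z => by simp [A_self_right]) fun k l hkl => (hpair k l hkl).2.2) x y

theorem domRestrict_weylOperator_eq_zero_iff_asdPart [FiniteDimensional ℝ V]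
    (b : Basis (Fin 4) ℝ V) {k : ℝ} (h : ∀ x y, M.ricci x y = 3 * k * M.form x y) :
    (M.weylOperator b).domRestrict (antiSelfDualForms b) = 0 ↔
      ∀ x y, asdPart b ((M.concircular k).A x y · ·) = 0 := by
  have hdim : finrank ℝ V = 4 := by simp [finrank_eq_card_basis b]
  simp only [domRestrict_weylOperator_eq_zero_iff, weyl_eq_A_concircular hdim h]
  exact ⟨fun h => (M.concircular k).asdPart_A_eq_zero_of_basis b fun k l hkl =>
    asdPart_eq_zero_iff.2 (h k l hkl), fun h k l _ => asdPart_eq_zero_iff.1 (h _ _)⟩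

end ASD

section SplitQuaternion

variable {M : CurvatureModel V} {b : Basis (Fin 4) ℝ V}

/-- Left multiplication `v ↦ (x ↦ v x)` of the split quaternions, with `b` in the role of
`1, i, j, k`: the first vector is the unit, the square of the second is `-1` and the squares of the
last two are `1`. -/
def splitMul (b : Basis (Fin 4) ℝ V) : V →ₗ[ℝ] V →ₗ[ℝ] V :=
  b.constr ℝ ![LinearMap.id, b.constr ℝ ![b 1, -b 0, -b 3, b 2],
    b.constr ℝ ![b 2, b 3, b 0, b 1], b.constr ℝ ![b 3, -b 2, -b 1, b 0]]

theorem splitMul_self_zero (x : V) : splitMul b (b 0) x = x := by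
  simp [splitMul]

theorem splitMul_zero_right (v : V) : splitMul b v (b 0) = v := by
  have : (splitMul b).flip (b 0) = LinearMap.id := b.ext fun i => by
    fin_cases i <;> simp [splitMul]
  exact LinearMap.congr_fun this v

theorem IsFrame.form_apply (hb : M.IsFrame b) (v w : V) :
    M.form v w = ∑ i, frameSign i * (b.repr v i * b.repr w i) := by
  conv_lhs => rw [← b.sum_repr v, ← b.sum_repr w]
  simp only [map_sum, map_smul, LinearMap.sum_apply, LinearMap.smul_apply, smul_eq_mul, hb _ _,
    mul_ite, mul_zero, Finset.sum_ite_eq', Finset.mem_univ, if_true]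
  exact Finset.sum_congr rfl fun i _ => by ring

theorem IsFrame.form_splitMul (hb : M.IsFrame b) (v w x : V) :
    M.form (splitMul b v x) (splitMul b w x) = -(M.form x x * M.form v w) := by
  simp [hb.form_apply, splitMul, Basis.constr_apply_fintype, Fin.sum_univ_four, frameSign]
  ring

theorem IsFrame.splitMul_skew (hb : M.IsFrame b) {u : V} (hu : M.form u (b 0) = 0) (w z : V) :
    M.form (splitMul b u w) z = -M.form w (splitMul b u z) := by
  have halt (x : V) : M.form (splitMul b u x) x = 0 := by
    simpa [splitMul_self_zero, hu] using hb.form_splitMul u (b 0) x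
  have := halt (w + z)
  simp only [map_add, LinearMap.add_apply, halt, zero_add, add_zero] at this
  rw [M.form_comm w]
  linarith

theorem IsFrame.asdPart_form_splitMul (hb : M.IsFrame b) (u : V) :
    asdPart b (fun x y => M.form (splitMul b u x) y) = 0 := by
  rw [asdPart_eq_zero_iff]
  refine ⟨?_, ?_, ?_⟩ <;>
    simp [hb.form_apply, splitMul, Basis.constr_apply_fintype, Fin.sum_univ_four, frameSign]

theorem IsFrame.eq_form_splitMul_of_asdPart_eq_zero (hb : M.IsFrame b)
    {B : LinearMap.BilinForm ℝ V} (hB : B.IsAlt) (hasd : asdPart b (B · ·) = 0) {u : V}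
    (hu : ∀ z, M.form u z = B (b 0) z) (w z : V) : B w z = M.form (splitMul b u w) z := by
  have hu0 : M.form u (b 0) = 0 := by rw [hu, hB]
  set C := B - M.form ∘ₗ splitMul b u with hC
  have hC_apply (x y : V) : C x y = B x y - M.form (splitMul b u x) y := rfl
  have hC_alt : C.IsAlt := fun x => by
    have := hb.splitMul_skew hu0 x x
    rw [M.form_comm x] at this
    rw [hC_apply, hB]
    linarith
  have hC_zero (y : V) : C (b 0) y = 0 := by rw [hC_apply, splitMul_zero_right, hu, sub_self]
  have hC_asd : asdPart b (C · ·) = 0 := by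
    simp only [asdPart_eq_zero_iff, hC_apply] at hasd ⊢
    obtain ⟨hB1, hB2, hB3⟩ := hasd
    obtain ⟨hu1, hu2, hu3⟩ := asdPart_eq_zero_iff.1 (hb.asdPart_form_splitMul u)
    exact ⟨by linarith only [hB1, hu1], by linarith only [hB2, hu2], by linarith only [hB3, hu3]⟩
  simp only [asdPart_eq_zero_iff, hC_zero, zero_sub, zero_add, neg_eq_zero] at hC_asd
  suffices C = 0 from sub_eq_zero.1 (LinearMap.congr_fun₂ this w z)
  refine bilin_eq_zero_of_isAlt b hC_alt fun k l hkl => ?_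
  fin_cases k <;> fin_cases l <;> simp_all

section SelfDual

variable [FiniteDimensional ℝ V]

theorem IsFrame.A_eq_form_splitMul (hb : M.IsFrame b) (hsd : ∀ x y, asdPart b (M.A x y · ·) = 0)
    (p q w z : V) : M.A p q w z = M.form (splitMul b (M.curv q (b 0) p) w) z :=
  hb.eq_form_splitMul_of_asdPart_eq_zero (B := M.A p q) (M.A_self_right p q) (hsd p q)
    (fun _ => M.form_curv _ _ _ _) w z

theorem IsFrame.jacobi_eq_splitMul (hb : M.IsFrame b) (hsd : ∀ x y, asdPart b (M.A x y · ·) = 0)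
    (x y : V) : M.jacobi x y = splitMul b (M.curv x (b 0) y) x :=
  M.ext_form fun z => by rw [form_jacobi, hb.A_eq_form_splitMul hsd]

theorem IsFrame.curv_splitMul (hb : M.IsFrame b) (hsd : ∀ x y, asdPart b (M.A x y · ·) = 0)
    (x v : V) :
    M.curv x (b 0) (splitMul b v x) = -(M.form x x • M.jacobi (b 0) v) := by
  refine M.ext_form fun z => ?_
  have hu : M.form (M.curv z (b 0) (b 0)) (b 0) = 0 := by rw [form_curv, A_self_right]
  calc M.form (M.curv x (b 0) (splitMul b v x)) z
      = M.form (splitMul b (M.curv z (b 0) (b 0)) (splitMul b v x)) x := by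
        rw [form_curv, M.A_pair_symm, hb.A_eq_form_splitMul hsd]
    _ = -M.form (splitMul b v x) (splitMul b (M.curv z (b 0) (b 0)) x) := hb.splitMul_skew hu _ _
    _ = M.form x x * M.A (b 0) z (b 0) v := by
        rw [hb.form_splitMul, neg_neg, M.form_comm v, form_curv]
    _ = M.form (-(M.form x x • M.jacobi (b 0) v)) z := by
        rw [M.A_antisymm_right, M.A_pair_symm (b 0) z]
        simp [form_jacobi]

variable {k : ℝ}

theorem IsFrame.jacobi_splitMul (hb : M.IsFrame b)
    (hsd : ∀ x y, asdPart b ((M.concircular k).A x y · ·) = 0) (x v : V) :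
    M.jacobi x (splitMul b v x) = -(M.form x x • splitMul b (M.jacobi (b 0) v) x) := by
  have hbN : (M.concircular k).IsFrame b := hb
  have hN : (M.concircular k).jacobi x (splitMul b v x) =
      -(M.form x x • splitMul b ((M.concircular k).jacobi (b 0) v) x) := by
    rw [hbN.jacobi_eq_splitMul hsd, hbN.curv_splitMul hsd, map_neg, map_smul, LinearMap.neg_apply,
      LinearMap.smul_apply, form_concircular]
  have hx : M.form x (splitMul b v x) = -(M.form x x * M.form (b 0) v) := by
    simpa [splitMul_self_zero] using hb.form_splitMul (b 0) v x
  have h00 : M.form (b 0) (b 0) = -1 := by simp [hb 0 0, frameSign]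
  simp only [jacobi_concircular, hx, h00, map_sub, map_smul, LinearMap.sub_apply,
    LinearMap.smul_apply, splitMul_self_zero, sub_eq_iff_eq_add] at hN
  rw [hN]
  module

theorem IsFrame.jordanOssermanOn_quadric (hb : M.IsFrame b)
    (hsd : ∀ x y, asdPart b ((M.concircular k).A x y · ·) = 0) {ε : ℝ} (hε : ε ≠ 0) :
    M.JordanOssermanOn (M.quadric ε) := by
  have hconj (x : V) (hx : x ∈ M.quadric ε) :
      ∃ e : V ≃ₗ[ℝ] V, e.conj (-(ε • M.jacobi (b 0))) = M.jacobi x := by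
    have hinj : Function.Injective ((splitMul b).flip x) :=
      LinearMap.ker_eq_bot.1 <| LinearMap.ker_eq_bot'.2 fun v hv => M.ext_form fun w => by
        have hvw := hb.form_splitMul v w x
        rw [show splitMul b v x = 0 from hv, hx.2] at hvw
        simpa [hε] using hvw
    refine ⟨LinearEquiv.ofInjectiveEndo _ hinj, ?_⟩
    rw [LinearEquiv.conj_apply, LinearEquiv.comp_toLinearMap_symm_eq]
    ext v
    simp [hb.jacobi_splitMul hsd, hx.2]
  intro x hx y hy
  obtain ⟨e, he⟩ := hconj x hx
  obtain ⟨f, hf⟩ := hconj y hy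
  exact ⟨e.symm.trans f, by
    rw [← he, ← hf, ← LinearEquiv.conj_trans, LinearEquiv.trans_apply, LinearEquiv.conj_symm_conj]⟩

theorem IsFrame.jacobi_comp_self_of_null (hb : M.IsFrame b)
    (hsd : ∀ x y, asdPart b ((M.concircular k).A x y · ·) = 0) {x : V} (hx : M.form x x = 0)
    (y : V) : M.jacobi x (M.jacobi x y) = 0 := by
  have hbN : (M.concircular k).IsFrame b := hb
  obtain ⟨v, hv⟩ : ∃ v, M.jacobi x y = splitMul b v x := by
    refine ⟨(M.concircular k).curv x (b 0) y - (k * M.form x y) • b 0, ?_⟩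
    rw [map_sub, LinearMap.sub_apply, ← hbN.jacobi_eq_splitMul hsd, jacobi_concircular, hx,
      map_smul, LinearMap.smul_apply, splitMul_self_zero]
    module
  rw [hv, hb.jacobi_splitMul hsd, hx, zero_smul, neg_zero]

theorem IsFrame.nullOsserman (hb : M.IsFrame b)
    (hsd : ∀ x y, asdPart b ((M.concircular k).A x y · ·) = 0) : M.NullOsserman := by
  have heig (x : V) (hx : x ∈ M.nullCone) : M.jacobiEigenvalues x = {0} :=
    M.jacobiEigenvalues_eq_zero_of_isNilpotent hx.1
      ⟨2, LinearMap.ext fun y => hb.jacobi_comp_self_of_null hsd hx.2 y⟩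
  exact fun x hx y hy => (heig x hx).trans (heig y hy).symm

end SelfDual

end SplitQuaternion

section NullVector

variable {M : CurvatureModel V} {b : Basis (Fin 4) ℝ V}

/-- The vectors `s ⊗ t` for an identification of `V` with a tensor product of two planes, such that
`⟨s ⊗ t, s' ⊗ t'⟩ = 2 det (s, s') det (t, t')` when `b` is an orthonormal basis. -/
def nullVector (b : Fin 4 → V) (s t : Fin 2 → ℝ) : V :=
  (s 0 * t 0) • (b 0 + b 2) + (s 0 * t 1) • (b 1 + b 3) + (s 1 * t 0) • (b 1 - b 3) +
    (s 1 * t 1) • (b 2 - b 0)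

/-- The basis of the opposite orientation with the last vector reversed. -/
def reflect (b : Basis (Fin 4) ℝ V) : Basis (Fin 4) ℝ V := b.unitsSMul ![1, 1, 1, -1]

theorem isFrame_reflect (hb : M.IsFrame b) : M.IsFrame (reflect b) := by
  intro i j
  simp only [reflect, Basis.unitsSMul_apply, map_smul, Units.smul_def,
    LinearMap.smul_apply, hb i j]
  fin_cases i <;> fin_cases j <;> simp

theorem nullVector_reflect (s t : Fin 2 → ℝ) :
    nullVector (reflect b) s t = nullVector b t s := by
  simp [nullVector, reflect, Basis.unitsSMul_apply, mul_comm, sub_eq_add_neg]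
  abel

theorem IsFrame.form_nullVector (hb : M.IsFrame b) (s t s' t' : Fin 2 → ℝ) :
    M.form (nullVector b s t) (nullVector b s' t') =
      2 * (s 0 * s' 1 - s 1 * s' 0) * (t 0 * t' 1 - t 1 * t' 0) := by
  simp [nullVector, hb _ _, frameSign]
  ring

/-- The values of the curvature on the totally null planes `{s ⊗ t : s ∈ ℝ²}`: a binary quartic
form in `t`, the spinor form of the anti-self-dual Weyl tensor. -/
def weylQuartic (M : CurvatureModel V) (b : Fin 4 → V) (t : Fin 2 → ℝ) : ℝ :=
  M.A (nullVector b ![1, 0] t) (nullVector b ![0, 1] t) (nullVector b ![0, 1] t)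
    (nullVector b ![1, 0] t)

theorem A_nullVector_left (b : Fin 4 → V) (s s' t : Fin 2 → ℝ) :
    M.A (nullVector b s t) (nullVector b s' t) (nullVector b s' t) (nullVector b s t) =
      (s 0 * s' 1 - s 1 * s' 0) ^ 2 * M.weylQuartic b t := by
  have h (s : Fin 2 → ℝ) : nullVector b s t =
      s 0 • nullVector b ![1, 0] t + s 1 • nullVector b ![0, 1] t := by
    simp [nullVector]
    module
  rw [h s, h s', weylQuartic]
  generalize nullVector b ![1, 0] t = x
  generalize nullVector b ![0, 1] t = y
  simp [A_self_left, A_self_right, M.A_antisymm y x, M.A_antisymm_right x y x y]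
  ring

theorem A_nullVector_right (b : Basis (Fin 4) ℝ V) (s t t' : Fin 2 → ℝ) :
    M.A (nullVector b s t) (nullVector b s t') (nullVector b s t') (nullVector b s t) =
      (t 0 * t' 1 - t 1 * t' 0) ^ 2 * M.weylQuartic (reflect b) s := by
  simp only [← nullVector_reflect (b := b), A_nullVector_left]

theorem IsFrame.weylQuartic_concircular (hb : M.IsFrame b) (k : ℝ) (t : Fin 2 → ℝ) :
    (M.concircular k).weylQuartic b t = M.weylQuartic b t := by
  simp [weylQuartic, A_concircular, hb.form_nullVector, mul_comm]

theorem exists_det_eq_one {s : Fin 2 → ℝ} (hs : s ≠ 0) : ∃ s' : Fin 2 → ℝ,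
    s 0 * s' 1 - s 1 * s' 0 = 1 := by
  have : s 0 ^ 2 + s 1 ^ 2 ≠ 0 := fun h => hs <| by
    ext i
    fin_cases i <;> simp <;> nlinarith [sq_nonneg (s 0), sq_nonneg (s 1)]
  refine ⟨![-s 1 / (s 0 ^ 2 + s 1 ^ 2), s 0 / (s 0 ^ 2 + s 1 ^ 2)], ?_⟩
  simp
  field_simp
  ring

variable [FiniteDimensional ℝ V]

theorem IsFrame.weylQuartic_mul_weylQuartic_reflect (hb : M.IsFrame b)
    (h : ∀ x, M.form x x = 0 → ∀ k ≠ 0, LinearMap.trace ℝ V (M.jacobi x ^ k) = 0)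
    {s t : Fin 2 → ℝ} (hs : s ≠ 0) (ht : t ≠ 0) :
    M.weylQuartic (reflect b) s * M.weylQuartic b t = 0 := by
  obtain ⟨s', hs'⟩ := exists_det_eq_one hs
  obtain ⟨t', ht'⟩ := exists_det_eq_one ht
  have hx : M.form (nullVector b s t) (nullVector b s t) = 0 := by
    rw [hb.form_nullVector]
    ring
  have htetrad := M.A_mul_A_eq_zero_of_nullTetrad (by simp [finrank_eq_card_basis b])
    (x := nullVector b s t) (y := (1 / 2 : ℝ) • nullVector b s' t') (u := nullVector b s t')
    (v := (-1 / 2 : ℝ) • nullVector b s' t) (fun i j => by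
      fin_cases i <;> fin_cases j <;> simp [hb.form_nullVector] <;> grind)
    (by simpa using h _ hx 1 one_ne_zero) (h _ hx 2 two_ne_zero)
  simp only [map_smul, LinearMap.smul_apply, smul_eq_mul, A_nullVector_left, A_nullVector_right]
    at htetrad
  grind

end NullVector

section WeylBlock

variable {M : CurvatureModel V}

theorem apply_nullVector {X : Type*} [AddCommGroup X] [Module ℝ X] (b : Fin 4 → V)
    {f : V →ₗ[ℝ] V →ₗ[ℝ] X} (hf : ∀ x, f x x = 0) (t : Fin 2 → ℝ) :
    f (nullVector b ![1, 0] t) (nullVector b ![0, 1] t) =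
      (t 0 ^ 2 + t 1 ^ 2) • asdPart b (f · ·) 0 + (2 * t 0 * t 1) • asdPart b (f · ·) 1 +
        (t 1 ^ 2 - t 0 ^ 2) • asdPart b (f · ·) 2 := by
  have hneg (x y : V) : f y x = -f x y := by
    have := hf (x + y)
    simp only [map_add, LinearMap.add_apply, hf, zero_add, add_zero] at this
    exact eq_neg_of_add_eq_zero_left this
  simp [nullVector, asdPart, hf, hneg (b 0), hneg (b 1) (b 2), hneg (b 1) (b 3), hneg (b 2) (b 3)]
  module

/-- The contraction of the first two arguments of the curvature tensor with the bivectors of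
`asdPart`. -/
def asdCurvature (M : CurvatureModel V) (b : Fin 4 → V) : Fin 3 → LinearMap.BilinForm ℝ V :=
  asdPart b (M.A · ·)

theorem asdCurvature_isAlt (b : Fin 4 → V) (a : Fin 3) : (M.asdCurvature b a).IsAlt := by
  intro x
  fin_cases a <;> simp [asdCurvature, asdPart, A_self_right]

theorem asdCurvature_apply (b : Fin 4 → V) (a : Fin 3) (x y : V) :
    M.asdCurvature b a x y = asdPart b (M.A x y · ·) a := by
  simp only [M.A_pair_symm x y]
  fin_cases a <;> rfl

/-- The block of the curvature operator between the anti-self-dual bivectors of two orthonormal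
bases. For `b' = b` it is the anti-self-dual block; for bases of opposite orientations it pairs
anti-self-dual with self-dual bivectors. -/
def curvatureBlock (M : CurvatureModel V) (b b' : Fin 4 → V) : Matrix (Fin 3) (Fin 3) ℝ :=
  Matrix.of fun a => asdPart b' (M.asdCurvature b a · ·)

theorem curvatureBlock_symm (b : Fin 4 → V) (a c : Fin 3) :
    M.curvatureBlock b b a c = M.curvatureBlock b b c a := by
  fin_cases a <;> fin_cases c <;> dsimp [curvatureBlock, asdCurvature, asdPart] <;>
    grind [M.A_pair_symm]

theorem asdPart_reflect (b : Basis (Fin 4) ℝ V) (B : LinearMap.BilinForm ℝ V) :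
    asdPart (reflect b) (B · ·) =
      ![B (b 0) (b 1) + B (b 2) (b 3), B (b 0) (b 2) + B (b 1) (b 3),
        B (b 1) (b 2) - B (b 0) (b 3)] := by
  simp [asdPart, reflect, Basis.unitsSMul_apply, neg_add_eq_sub]

theorem weylQuartic_eq (b : Fin 4 → V) (t : Fin 2 → ℝ) : M.weylQuartic b t =
    -(![t 0 ^ 2 + t 1 ^ 2, 2 * t 0 * t 1, t 1 ^ 2 - t 0 ^ 2] ⬝ᵥ
      M.curvatureBlock b b *ᵥ ![t 0 ^ 2 + t 1 ^ 2, 2 * t 0 * t 1, t 1 ^ 2 - t 0 ^ 2]) := by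
  have hA (x : V) : M.A x x = 0 := LinearMap.ext₂ fun _ _ => M.A_self_left _ _ _
  rw [weylQuartic, A_antisymm_right]
  rw [apply_nullVector (X := LinearMap.BilinForm ℝ V) b hA]
  change -((_ • M.asdCurvature b 0 + _ • M.asdCurvature b 1 + _ • M.asdCurvature b 2 :
    LinearMap.BilinForm ℝ V) _ _) = _
  simp only [LinearMap.add_apply, LinearMap.smul_apply, apply_nullVector b (asdCurvature_isAlt b _)]
  simp [Matrix.mulVec, dotProduct, Fin.sum_univ_three, curvatureBlock]
  ring

theorem curvatureBlock_eq_zero_of_weylQuartic (b : Fin 4 → V)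
    (htrace : M.curvatureBlock b b 0 0 = M.curvatureBlock b b 1 1 + M.curvatureBlock b b 2 2)
    (h : ∀ t ≠ 0, M.weylQuartic b t = 0) : M.curvatureBlock b b = 0 := by
  have hquad (x y : ℝ) (hxy : ![x, y] ≠ 0) := h ![x, y] hxy
  simp only [weylQuartic_eq, Matrix.mulVec, dotProduct, Fin.sum_univ_three, Matrix.cons_val,
    curvatureBlock_symm b 1 0, curvatureBlock_symm b 2] at hquad
  have h10 := hquad 1 0 (by simp)
  have h01 := hquad 0 1 (by simp)
  have h11 := hquad 1 1 (by simp)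
  have h1m := hquad 1 (-1) (by simp)
  have h21 := hquad 2 1 (by simp)
  ext a c
  fin_cases a <;> fin_cases c <;>
    simp only [Fin.zero_eta, Fin.mk_one, Fin.reduceFinMk, Matrix.zero_apply,
      curvatureBlock_symm b 1 0, curvatureBlock_symm b 2] <;>
    linarith

end WeylBlock

section RicciFlat

variable [FiniteDimensional ℝ V] {M : CurvatureModel V} {b : Basis (Fin 4) ℝ V}

theorem IsFrame.ricci_eq_sum (hb : M.IsFrame b) (x y : V) :
    M.ricci x y = ∑ i, frameSign i * M.A (b i) x y (b i) := by
  rw [ricci_apply, trace_eq_sum_of_dual (M := M) (b := b) (b' := fun i => frameSign i • b i)]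
  · simp [form_curv]
  · intro i j
    rw [map_smul, hb]
    fin_cases i <;> fin_cases j <;> simp [frameSign]

theorem IsFrame.A_add_A_eq_of_ricci_eq_zero (hb : M.IsFrame b) (hric : M.ricci = 0) (x y : V) :
    M.A (b 2) x y (b 2) + M.A (b 3) x y (b 3) = M.A (b 0) x y (b 0) + M.A (b 1) x y (b 1) := by
  have hsum := hb.ricci_eq_sum x y
  simp only [hric, LinearMap.zero_apply, Fin.sum_univ_four, frameSign, Matrix.cons_val] at hsum
  linarith

theorem IsFrame.curvatureBlock_zero_zero (hb : M.IsFrame b) (hric : M.ricci = 0) :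
    M.curvatureBlock b b 0 0 = M.curvatureBlock b b 1 1 + M.curvatureBlock b b 2 2 := by
  have hric_diag (i) := hb.A_add_A_eq_of_ricci_eq_zero hric (b i) (b i)
  have h0 := hric_diag 0
  have h1 := hric_diag 1
  have h2 := hric_diag 2
  have h3 := hric_diag 3
  have hbianchi := M.A_bianchi (b 0) (b 1) (b 2) (b 3)
  dsimp [curvatureBlock, asdCurvature, asdPart]
  clear hric_diag
  grind [M.A_self_left, M.A_antisymm, M.A_pair_symm]

theorem IsFrame.curvatureBlock_reflect (hb : M.IsFrame b) (hric : M.ricci = 0) :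
    M.curvatureBlock b (reflect b) = 0 := by
  have hcomp (i j) := hb.A_add_A_eq_of_ricci_eq_zero hric (b i) (b j)
  have h00 := hcomp 0 0
  have h11 := hcomp 1 1
  have h22 := hcomp 2 2
  have h33 := hcomp 3 3
  have h01 := hcomp 0 1
  have h02 := hcomp 0 2
  have h03 := hcomp 0 3
  have h12 := hcomp 1 2
  have h13 := hcomp 1 3
  have h23 := hcomp 2 3
  clear hcomp
  refine funext fun a => ?_
  change asdPart (reflect b) (M.asdCurvature b a · ·) = 0
  rw [asdPart_reflect, Matrix.cons_eq_zero_iff, Matrix.cons_eq_zero_iff, Matrix.cons_eq_zero_iff]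
  fin_cases a <;> refine ⟨?_, ?_, ?_, Subsingleton.elim _ _⟩ <;>
    dsimp [asdCurvature, asdPart] <;> grind [M.A_self_left, M.A_antisymm, M.A_pair_symm]

end RicciFlat

section Osserman

variable {M : CurvatureModel V} {b : Basis (Fin 4) ℝ V}

theorem eq_zero_of_asdPart_of_asdPart_reflect (b : Basis (Fin 4) ℝ V)
    {B : LinearMap.BilinForm ℝ V} (hB : B.IsAlt) (h : asdPart b (B · ·) = 0)
    (h' : asdPart (reflect b) (B · ·) = 0) : B = 0 := by
  rw [asdPart_reflect, Matrix.cons_eq_zero_iff, Matrix.cons_eq_zero_iff,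
    Matrix.cons_eq_zero_iff] at h'
  obtain ⟨h01, h02, h03⟩ := asdPart_eq_zero_iff.1 h
  obtain ⟨h01', h02', h03', -⟩ := h'
  refine bilin_eq_zero_of_isAlt b hB fun k l hkl => ?_
  fin_cases k <;> fin_cases l <;> first | (exact absurd hkl (by decide)) | (dsimp; linarith)

variable [FiniteDimensional ℝ V]

theorem IsFrame.asdPart_A_eq_zero_of_weylQuartic (hb : M.IsFrame b) (hric : M.ricci = 0)
    (h : ∀ t ≠ 0, M.weylQuartic b t = 0) (x y : V) : asdPart b (M.A x y · ·) = 0 := by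
  have hblock := curvatureBlock_eq_zero_of_weylQuartic b (hb.curvatureBlock_zero_zero hric) h
  ext a
  rw [← asdCurvature_apply, eq_zero_of_asdPart_of_asdPart_reflect b (asdCurvature_isAlt b a)
    (congr_fun hblock a) (congr_fun (hb.curvatureBlock_reflect hric) a)]
  rfl

theorem IsFrame.isSelfDual_of_weylQuartic (hb : M.IsFrame b) (hE : M.IsEinstein)
    (h : ∀ t ≠ 0, M.weylQuartic b t = 0) : M.IsSelfDual b.orientation := by
  obtain ⟨c, hc⟩ := hE
  have hk (x y : V) : M.ricci x y = 3 * (c / 3) * M.form x y := by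
    rw [hc]
    ring
  have hflat : (M.concircular (c / 3)).ricci = 0 := by
    ext x y
    rw [ricci_concircular, hk, finrank_eq_card_basis b, Fintype.card_fin, LinearMap.zero_apply,
      LinearMap.zero_apply]
    push_cast
    ring
  have hbN : (M.concircular (c / 3)).IsFrame b := hb
  refine ⟨b, ⟨rfl, hb⟩, (M.domRestrict_weylOperator_eq_zero_iff_asdPart b hk).2 ?_⟩
  refine hbN.asdPart_A_eq_zero_of_weylQuartic hflat fun t ht => ?_
  rw [hb.weylQuartic_concircular, h t ht]

theorem isEinstein_and_exists_isSelfDual_of_trace_jacobi_pow (hM : M.IsNeutral)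
    (h : ∀ x, M.form x x = 0 → ∀ k ≠ 0, LinearMap.trace ℝ V (M.jacobi x ^ k) = 0) :
    M.IsEinstein ∧ ∃ o : Orientation ℝ V (Fin 4), M.IsSelfDual o := by
  obtain ⟨b, hb⟩ := hM.exists_isFrame
  have hnull : M.form (b 0 + b 2) (b 0 + b 2) = 0 := by simp [hb _ _, frameSign]
  have hne : b 0 + b 2 ≠ 0 := fun h0 => by
    simpa [hb _ _, frameSign] using congr_arg (M.form (b 0)) h0
  have hE : M.IsEinstein := M.isEinstein_of_trace_jacobi_eq_zero hnull hne fun x hx => by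
    simpa using h x hx 1 one_ne_zero
  refine ⟨hE, ?_⟩
  by_cases hquartic : ∀ t ≠ 0, M.weylQuartic b t = 0
  · exact ⟨_, hb.isSelfDual_of_weylQuartic hE hquartic⟩
  · push Not at hquartic
    obtain ⟨t, ht, hqt⟩ := hquartic
    refine ⟨_, (isFrame_reflect hb).isSelfDual_of_weylQuartic hE fun s hs => ?_⟩
    exact (mul_eq_zero.1 (hb.weylQuartic_mul_weylQuartic_reflect h hs ht)).resolve_right hqt

theorem OssermanOn.isEinstein_and_exists_isSelfDual (hM : M.IsNeutral) {ε : ℝ}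
    (h : M.OssermanOn (M.quadric ε)) :
    M.IsEinstein ∧ ∃ o : Orientation ℝ V (Fin 4), M.IsSelfDual o :=
  isEinstein_and_exists_isSelfDual_of_trace_jacobi_pow hM fun _ hx _ hk =>
    h.trace_jacobi_pow_eq_zero hx hk

theorem IsSelfDual.exists_isFrame_asdPart_eq_zero {o : Orientation ℝ V (Fin 4)}
    (h : M.IsSelfDual o) (hE : M.IsEinstein) : ∃ b : Basis (Fin 4) ℝ V, M.IsFrame b ∧
      ∃ k, ∀ x y, asdPart b ((M.concircular k).A x y · ·) = 0 := by
  obtain ⟨c, hc⟩ := hE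
  obtain ⟨b, ⟨-, hb⟩, hW⟩ := h
  refine ⟨b, hb, c / 3, (M.domRestrict_weylOperator_eq_zero_iff_asdPart b fun x y => ?_).1 hW⟩
  rw [hc]
  ring

theorem IsSelfDual.jordanOssermanOn_quadric {o : Orientation ℝ V (Fin 4)} (h : M.IsSelfDual o)
    (hE : M.IsEinstein) {ε : ℝ} (hε : ε ≠ 0) : M.JordanOssermanOn (M.quadric ε) := by
  obtain ⟨b, hb, k, hsd⟩ := h.exists_isFrame_asdPart_eq_zero hE
  exact hb.jordanOssermanOn_quadric hsd hε

theorem IsSelfDual.nullOsserman {o : Orientation ℝ V (Fin 4)} (h : M.IsSelfDual o)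
    (hE : M.IsEinstein) : M.NullOsserman := by
  obtain ⟨b, hb, k, hsd⟩ := h.exists_isFrame_asdPart_eq_zero hE
  exact hb.nullOsserman hsd

end Osserman

end

end CurvatureModel

theorem theorem1p1 {V : Type*} [AddCommGroup V] [Module ℝ V] [FiniteDimensional ℝ V]
    (M : CurvatureModel V) (hM : M.IsNeutral) :
    List.TFAE [
      M.SpacelikeOsserman,
      M.TimelikeOsserman,
      M.SpacelikeJordanOsserman,
      M.TimelikeJordanOsserman,
      M.IsEinstein ∧ ∃ o : Orientation ℝ V (Fin 4), M.IsSelfDual o,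
      M.NullOsserman] := by
  simp only [CurvatureModel.SpacelikeOsserman, CurvatureModel.TimelikeOsserman,
    CurvatureModel.SpacelikeJordanOsserman, CurvatureModel.TimelikeJordanOsserman,
    M.spacelikeUnit_eq_quadric, M.timelikeUnit_eq_quadric]
  tfae_have 1 → 5 := fun h => h.isEinstein_and_exists_isSelfDual hM
  tfae_have 2 → 5 := fun h => h.isEinstein_and_exists_isSelfDual hM
  tfae_have 6 → 5 := fun h : M.OssermanOn (M.quadric 0) => h.isEinstein_and_exists_isSelfDual hM
  tfae_have 5 → 3 := fun ⟨hE, _, hsd⟩ => hsd.jordanOssermanOn_quadric hE one_ne_zero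
  tfae_have 5 → 4 := fun ⟨hE, _, hsd⟩ =>
    hsd.jordanOssermanOn_quadric hE (neg_ne_zero.2 one_ne_zero)
  tfae_have 5 → 6 := fun ⟨hE, _, hsd⟩ => hsd.nullOsserman hE
  tfae_have 3 → 1 := fun h => h.ossermanOn
  tfae_have 4 → 2 := fun h => h.ossermanOn
  tfae_finish
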